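/- For $j\in\{1,2\}$ let $(M_j,\omega_j)$ be a compact connected Kähler manifold of complex dimension $d_j\ge 1$, and let $(L_j,h_j)$ be a holomorphic Hermitian line bundle on $M_j$ (for instance a very ample prequantum line bundle). Equip the space of global holomorphic sections $H^0(M_j,L_j)$ with the inner product $$\langle s,t\rangle_j=\int_{M_j}h_j(s,t)\,\frac{\omega_j^{d_j}}{d_j!},$$ and put $\mathcal H_A=H^0(M_1,L_1)$, $\mathcal H_B=H^0(M_2,L_2)$. For a subset $\Lambda$ of $M_1$, of $M_2$ or of $M_1\times M_2$, let $\mathcal R_\Lambda$ be the linear map which restricts a holomorphic section of $L_1$, of $L_2$ or of $L_1\boxtimes L_2$, respectively, to $\Lambda$; its values are arbitrary set-theoretic sections over $\Lambda$. The canonical linear map $\mathcal H_A\otimes\mathcal H_B\to H^0(M_1\times M_2,L_1\boxtimes L_2)$, which sends $u\otimes v$ to the section $(x,y)\mapsto u(x)\otimes v(y)$, is bijective. Through it regard $\ker\mathcal R_\Lambda$, for $\Lambda\subset M_1\times M_2$, as a subspace of $\mathcal H_A\otimes\mathcal H_B$ with the inner product determined by $\langle u\otimes v,u'\otimes v'\rangle=\langle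 u,u'\rangle_1\langle v,v'\rangle_2$. Let $\Lambda_1\subset M_1$ and $\Lambda_2\subset M_2$ be non-empty subsets, at least one of which is a singleton. Then $$\ker(\mathcal R_{\Lambda_1\times\Lambda_2})=\bigl[\mathcal H_A\otimes\ker(\mathcal R_{\Lambda_2})\bigr]\oplus\bigl[\ker(\mathcal R_{\Lambda_1})\otimes\ker(\mathcal R_{\Lambda_2})^{\perp}\bigr],$$ where the sum is direct and orthogonal, and $$\ker(\mathcal R_{\Lambda_1\times\Lambda_2})^{\perp}=\ker(\mathcal R_{\Lambda_1})^{\perp}\otimes\ker(\mathcal R_{\Lambda_2})^{\perp}.$$ -/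

import Mathlib

open scoped Manifold ContDiff Bundle TensorProduct ComplexConjugate
open MeasureTheory Bundle

/-- The model space `ℂ^d` of a complex manifold of dimension `d`. -/
abbrev CModel (d : ℕ) : Type := EuclideanSpace ℂ (Fin d)

/-- The real basis `e₁, …, e_d, i e₁, …, i e_d` of `ℂ^d`. -/
noncomputable def realFrame (d : ℕ) : Module.Basis (Fin 2 × Fin d) ℝ (CModel d) :=
  Complex.basisOneI.smulTower (EuclideanSpace.basisFun (Fin d) ℂ).toBasis

/-- The coordinate expression, on `ℂ^d`, of a real `2`-form `form` on `M` in the chart `e`: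
its pullback by `e.symm`. -/
noncomputable def formInChart {d : ℕ} {M : Type*} [TopologicalSpace M] [ChartedSpace (CModel d) M]
    (form : ∀ x : M, TangentSpace 𝓘(ℂ, CModel d) x [⋀^Fin 2]→L[ℝ] ℝ)
    (e : OpenPartialHomeomorph M (CModel d)) (z : CModel d) : CModel d [⋀^Fin 2]→L[ℝ] ℝ :=
  (form (e.symm z)).compContinuousLinearMap
    ((mfderiv 𝓘(ℂ, CModel d) 𝓘(ℂ, CModel d) e.symm z).restrictScalars ℝ)

/-- A Kähler form on a complex manifold `M` of dimension `d`: a smooth real `2`-form which is of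
type `(1,1)`, positive and closed. -/
structure KahlerForm (d : ℕ) (M : Type*) [TopologicalSpace M] [ChartedSpace (CModel d) M] where
  form : ∀ x : M, TangentSpace 𝓘(ℂ, CModel d) x [⋀^Fin 2]→L[ℝ] ℝ
  type_one_one : ∀ (x : M) (u v : TangentSpace 𝓘(ℂ, CModel d) x),
    form x ![Complex.I • u, Complex.I • v] = form x ![u, v]
  pos : ∀ (x : M) (v : TangentSpace 𝓘(ℂ, CModel d) x), v ≠ 0 → 0 < form x ![v, Complex.I • v]
  smooth : ∀ e ∈ atlas (CModel d) M, ContDiffOn ℝ ∞ (formInChart form e) e.target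
  closed : ∀ e ∈ atlas (CModel d) M, ∀ z ∈ e.target, extDeriv (formInChart form e) z = 0

namespace KahlerForm

variable {d : ℕ} {M : Type*} [TopologicalSpace M] [ChartedSpace (CModel d) M]

/-- The density, with respect to Lebesgue measure on `ℂ^d`, of the volume form `ω ^ d / d!` in the
chart `e`. In the real frame `b` the density of `ω ^ d / d!` is the Pfaffian of the matrix
`ω (b i, b j)`, with the sign given by the complex orientation; it is positive, hence equal to the
square root of the absolute value of the determinant. -/
noncomputable def density (K : KahlerForm d M) (e : OpenPartialHomeomorph M (CModel d))
    (z : CModel d) : ℝ :=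
  √|(Matrix.of fun i j ↦ formInChart K.form e z ![realFrame d i, realFrame d j]).det|

/-- The measure of the volume form `ω ^ d / d!` on the domain of the chart `e`. -/
noncomputable def chartVolume [MeasurableSpace M] (K : KahlerForm d M)
    (e : OpenPartialHomeomorph M (CModel d)) : Measure M :=
  ((MeasureTheory.volume.restrict e.target).withDensity
    fun z ↦ ENNReal.ofReal (K.density e z)).map e.symm

/-- The measure on `M` associated to the volume form `ω ^ d / d!`: the least measure dominating
its coordinate expression in every chart. These expressions agree on overlaps of charts, and
`volume_restrict_source` shows that the measure restricts to each of them. -/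
noncomputable def volume [MeasurableSpace M] (K : KahlerForm d M) : Measure M :=
  ⨆ e ∈ atlas (CModel d) M, K.chartVolume e

end KahlerForm

/-- A smooth Hermitian metric on a holomorphic line bundle: a Hermitian inner product on every fibre,
conjugate-linear in the first argument, such that the squared norm of the frame of every local
trivialization is smooth. -/
structure HermitianMetric (d : ℕ) {M : Type*} [TopologicalSpace M] [ChartedSpace (CModel d) M]
    (L : M → Type*) [TopologicalSpace (TotalSpace ℂ L)] [∀ x, AddCommGroup (L x)]
    [∀ x, Module ℂ (L x)] [∀ x, TopologicalSpace (L x)] [FiberBundle ℂ L] where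
  inner : ∀ x : M, L x →ₗ⋆[ℂ] L x →ₗ[ℂ] ℂ
  symm : ∀ (x : M) (u v : L x), conj (inner x v u) = inner x u v
  pos : ∀ (x : M) (v : L x), v ≠ 0 → 0 < (inner x v v).re
  smooth : ∀ (e : Trivialization ℂ (π ℂ L)) [MemTrivializationAtlas e],
    ContMDiffOn 𝓘(ℝ, CModel d) 𝓘(ℝ, ℂ) ∞ (fun x ↦ inner x (e.symm x 1) (e.symm x 1)) e.baseSet

theorem update_head_vec2 {α : Type*} (u v w : α) :
    Function.update ![u, v] 0 w = ![w, v] := by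
  ext i; fin_cases i <;> rfl

theorem update_snd_vec2 {α : Type*} (u v w : α) :
    Function.update ![u, v] 1 w = ![u, w] := by
  ext i; fin_cases i <;> rfl

/-- A `2`-form as a bilinear form. -/
def twoFormBilin {E : Type*} [NormedAddCommGroup E] [NormedSpace ℝ E] (f : E [⋀^Fin 2]→L[ℝ] ℝ) :
    E →ₗ[ℝ] E →ₗ[ℝ] ℝ :=
  LinearMap.mk₂ ℝ (fun u v ↦ f ![u, v])
    (fun u u' v ↦ by
      have h := f.map_update_add ![u, v] 0 u u'
      simp only [update_head_vec2] at h
      exact h)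
    (fun c u v ↦ by
      have h := f.map_update_smul ![u, v] 0 c u
      simp only [update_head_vec2] at h
      exact h)
    (fun u v v' ↦ by
      have h := f.map_update_add ![u, v] 1 v v'
      simp only [update_snd_vec2] at h
      exact h)
    (fun c u v ↦ by
      have h := f.map_update_smul ![u, v] 1 c v
      simp only [update_snd_vec2] at h
      exact h)

theorem twoForm_swap {E : Type*} [AddCommGroup E] [Module ℝ E] [TopologicalSpace E]
    (f : E [⋀^Fin 2]→L[ℝ] ℝ) (u v : E) : f ![u, v] = - f ![v, u] := by
  have h := f.map_swap ![v, u] (i := 0) (j := 1) (by decide)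
  have h2 : ![v, u] ∘ Equiv.swap (0 : Fin 2) 1 = ![u, v] := by
    ext i
    fin_cases i <;> rfl
  rw [h2] at h
  exact h

namespace KahlerForm

variable {d : ℕ} {M : Type*} [TopologicalSpace M] [ChartedSpace (CModel d) M]

theorem continuousOn_density (K : KahlerForm d M) {e : OpenPartialHomeomorph M (CModel d)}
    (he : e ∈ atlas (CModel d) M) : ContinuousOn (K.density e) e.target := by
  have h := (K.smooth e he).continuousOn
  refine (Real.continuous_sqrt.comp continuous_abs).comp_continuousOn ?_
  refine (Continuous.matrix_det continuous_id).comp_continuousOn ?_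
  refine continuousOn_pi.2 fun i ↦ continuousOn_pi.2 fun j ↦ ?_
  exact (ContinuousAlternatingMap.apply ℝ (CModel d) ℝ
    ![realFrame d i, realFrame d j]).continuous.comp_continuousOn h

theorem mfderiv_symm_injective [IsManifold 𝓘(ℂ, CModel d) ω M]
    {e : OpenPartialHomeomorph M (CModel d)}
    (he : e ∈ atlas (CModel d) M) {z : CModel d} (hz : z ∈ e.target) :
    Function.Injective (mfderiv 𝓘(ℂ, CModel d) 𝓘(ℂ, CModel d) e.symm z) := by
  have : IsManifold 𝓘(ℂ, CModel d) 1 M := IsManifold.of_le (n := ω) le_top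
  exact ((mdifferentiable_of_mem_atlas he).symm.mfderiv_bijective (x := z) hz).1

theorem formInChart_apply
    (form : ∀ x : M, TangentSpace 𝓘(ℂ, CModel d) x [⋀^Fin 2]→L[ℝ] ℝ)
    (e : OpenPartialHomeomorph M (CModel d)) (z u v : CModel d) :
    formInChart form e z ![u, v] = form (e.symm z)
      ![mfderiv 𝓘(ℂ, CModel d) 𝓘(ℂ, CModel d) e.symm z u,
        mfderiv 𝓘(ℂ, CModel d) 𝓘(ℂ, CModel d) e.symm z v] := by
  refine congrArg (form (e.symm z)) (funext fun i ↦ ?_)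
  fin_cases i <;> rfl

theorem formInChart_pos [IsManifold 𝓘(ℂ, CModel d) ω M] (K : KahlerForm d M)
    {e : OpenPartialHomeomorph M (CModel d)}
    (he : e ∈ atlas (CModel d) M) {z : CModel d} (hz : z ∈ e.target) {v : CModel d} (hv : v ≠ 0) :
    0 < formInChart K.form e z ![v, Complex.I • v] := by
  rw [formInChart_apply]
  have h0 : mfderiv 𝓘(ℂ, CModel d) 𝓘(ℂ, CModel d) e.symm z v ≠ 0 := fun h ↦
    hv (mfderiv_symm_injective he hz (h.trans (map_zero _).symm))
  have := K.pos (e.symm z) _ h0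
  have h1 : mfderiv 𝓘(ℂ, CModel d) 𝓘(ℂ, CModel d) e.symm z (Complex.I • v) =
      Complex.I • mfderiv 𝓘(ℂ, CModel d) 𝓘(ℂ, CModel d) e.symm z v :=
    ContinuousLinearMap.map_smul (mfderiv 𝓘(ℂ, CModel d) 𝓘(ℂ, CModel d) e.symm z) Complex.I v
  exact h1 ▸ this

theorem toMatrix_formInChart (K : KahlerForm d M) (e : OpenPartialHomeomorph M (CModel d))
    (z : CModel d) :
    (Matrix.of fun i j ↦ formInChart K.form e z ![realFrame d i, realFrame d j]) =
      LinearMap.toMatrix₂ (realFrame d) (realFrame d) (twoFormBilin (formInChart K.form e z)) := by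
  ext i j
  rw [LinearMap.toMatrix₂_apply]
  rfl

theorem density_pos [IsManifold 𝓘(ℂ, CModel d) ω M] (K : KahlerForm d M)
    {e : OpenPartialHomeomorph M (CModel d)}
    (he : e ∈ atlas (CModel d) M) {z : CModel d} (hz : z ∈ e.target) : 0 < K.density e z := by
  refine Real.sqrt_pos.2 (abs_pos.2 fun hdet ↦ ?_)
  obtain ⟨c, hc, hc'⟩ := Matrix.exists_mulVec_eq_zero_iff.2 hdet
  set v : CModel d := ∑ j, c j • realFrame d j with hv
  have hv0 : v ≠ 0 := fun h ↦ hc (funext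
    (Fintype.linearIndependent_iff.1 (realFrame d).linearIndependent c h))
  have hB : ∀ i, twoFormBilin (formInChart K.form e z) (realFrame d i) v = 0 := by
    intro i
    have := congrFun hc' i
    rw [hv, map_sum]
    simp only [map_smul, smul_eq_mul]
    refine Eq.trans (Finset.sum_congr rfl fun j _ ↦ ?_) this
    rw [mul_comm]
    rfl
  have hB' : (twoFormBilin (formInChart K.form e z)).flip v = 0 :=
    (realFrame d).ext fun i ↦ hB i
  have h1 : formInChart K.form e z ![Complex.I • v, v] = 0 := LinearMap.congr_fun hB' _
  have h2 := K.formInChart_pos he hz hv0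
  rw [twoForm_swap, h1] at h2
  simp at h2

theorem formInChart_comp [IsManifold 𝓘(ℂ, CModel d) ω M] (K : KahlerForm d M)
    {e e' : OpenPartialHomeomorph M (CModel d)}
    (he : e ∈ atlas (CModel d) M) (he' : e' ∈ atlas (CModel d) M) {z : CModel d}
    (hz : z ∈ e.target) (hz' : e.symm z ∈ e'.source) :
    DifferentiableAt ℝ (e' ∘ e.symm) z ∧
    ∀ u v, formInChart K.form e z ![u, v] = formInChart K.form e' (e' (e.symm z))
      ![fderiv ℝ (e' ∘ e.symm) z u, fderiv ℝ (e' ∘ e.symm) z v] := by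
  have : IsManifold 𝓘(ℂ, CModel d) 1 M := IsManifold.of_le (n := ω) le_top
  have h1 := (mdifferentiable_of_mem_atlas (I := 𝓘(ℂ, CModel d)) he).mdifferentiableAt_symm hz
  have h2 := (mdifferentiable_of_mem_atlas (I := 𝓘(ℂ, CModel d)) he').mdifferentiableAt hz'
  have h3 := (mdifferentiable_of_mem_atlas (I := 𝓘(ℂ, CModel d)) he').mdifferentiableAt_symm
    (e'.map_source hz')
  have h4 : DifferentiableAt ℂ (e' ∘ e.symm) z := (h2.comp z h1).differentiableAt
  have h5 : fderiv ℝ (e' ∘ e.symm) z = (fderiv ℂ (e' ∘ e.symm) z).restrictScalars ℝ :=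
    h4.fderiv_restrictScalars ℝ
  refine ⟨h4.restrictScalars ℝ, fun u v ↦ ?_⟩
  have h6 : mfderiv 𝓘(ℂ, CModel d) 𝓘(ℂ, CModel d) e.symm z =
      (mfderiv 𝓘(ℂ, CModel d) 𝓘(ℂ, CModel d) e'.symm (e' (e.symm z))).comp
        (fderiv ℂ (e' ∘ e.symm) z) := by
    have h7 : e.symm =ᶠ[nhds z] e'.symm ∘ (e' ∘ e.symm) := by
      have : e.symm ⁻¹' e'.source ∈ nhds z :=
        (e.continuousAt_symm hz).preimage_mem_nhds (e'.open_source.mem_nhds hz')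
      filter_upwards [this] with w hw
      exact (e'.left_inv hw).symm
    rw [h7.mfderiv_eq, mfderiv_comp z (I' := 𝓘(ℂ, CModel d)) h3 h4.mdifferentiableAt,
      mfderiv_eq_fderiv]
    rfl
  rw [formInChart_apply, formInChart_apply, h5, e'.left_inv hz', h6]
  rfl

theorem density_comp [IsManifold 𝓘(ℂ, CModel d) ω M] (K : KahlerForm d M)
    {e e' : OpenPartialHomeomorph M (CModel d)}
    (he : e ∈ atlas (CModel d) M) (he' : e' ∈ atlas (CModel d) M) {z : CModel d}
    (hz : z ∈ e.target) (hz' : e.symm z ∈ e'.source) :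
    K.density e z = |(fderiv ℝ (e' ∘ e.symm) z).det| * K.density e' (e' (e.symm z)) := by
  have h := (K.formInChart_comp he he' hz hz').2
  set T := fderiv ℝ (e' ∘ e.symm) z
  have h1 : twoFormBilin (formInChart K.form e z) =
      (twoFormBilin (formInChart K.form e' (e' (e.symm z)))).compl₁₂ (T : CModel d →ₗ[ℝ] CModel d)
        (T : CModel d →ₗ[ℝ] CModel d) := by
    ext u v
    exact h u v
  unfold density
  rw [toMatrix_formInChart, toMatrix_formInChart, h1,
    LinearMap.toMatrix₂_compl₁₂ (realFrame d) (realFrame d), Matrix.det_mul, Matrix.det_mul,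
    Matrix.det_transpose, LinearMap.det_toMatrix, abs_mul, abs_mul, mul_right_comm,
    Real.sqrt_mul (by positivity), Real.sqrt_mul_self (abs_nonneg _)]

theorem le_volume [MeasurableSpace M] (K : KahlerForm d M) {e : OpenPartialHomeomorph M (CModel d)}
    (he : e ∈ atlas (CModel d) M) : K.chartVolume e ≤ K.volume :=
  le_iSup₂ (f := fun e (_ : e ∈ atlas (CModel d) M) ↦ K.chartVolume e) e he

end KahlerForm

namespace KahlerForm

theorem measurableSet_target_inter {d : ℕ} {M : Type*} [TopologicalSpace M] [MeasurableSpace M]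
    [BorelSpace M] (e : OpenPartialHomeomorph M (CModel d)) {A : Set M}
    (hA : MeasurableSet A) : MeasurableSet (e.target ∩ e.symm ⁻¹' A) := by
  have h : Measurable (e.target.domRestrict e.symm) :=
    (continuousOn_iff_continuous_domRestrict.1 e.continuousOn_symm).measurable
  have h2 := e.open_target.measurableSet.subtype_image (h hA)
  convert h2 using 1
  ext z
  simp [Set.domRestrict, and_comm]

variable {d : ℕ} {M : Type*} [TopologicalSpace M] [ChartedSpace (CModel d) M]
  [MeasurableSpace M] [BorelSpace M]

theorem chartVolume_apply (K : KahlerForm d M) (e : OpenPartialHomeomorph M (CModel d))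
    {A : Set M} (hA : MeasurableSet A) : K.chartVolume e A =
      ∫⁻ z in e.target ∩ e.symm ⁻¹' A, ENNReal.ofReal (K.density e z) := by
  have hm : AEMeasurable e.symm ((MeasureTheory.volume.restrict e.target).withDensity
      fun z ↦ ENNReal.ofReal (K.density e z)) :=
    (e.continuousOn_symm.aemeasurable e.open_target.measurableSet).mono_ac
      (withDensity_absolutelyContinuous _ _)
  have hm2 : NullMeasurableSet (e.symm ⁻¹' A) (MeasureTheory.volume.restrict e.target) :=
    (e.continuousOn_symm.aemeasurable e.open_target.measurableSet).nullMeasurableSet_preimage hA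
  rw [chartVolume, Measure.map_apply_of_aemeasurable hm hA,
    withDensity_apply₀ _ hm2, Measure.restrict_restrict₀ hm2, Set.inter_comm]

theorem chartVolume_compl_source (K : KahlerForm d M) (e : OpenPartialHomeomorph M (CModel d)) :
    K.chartVolume e e.sourceᶜ = 0 := by
  rw [chartVolume_apply _ _ e.open_source.measurableSet.compl]
  have : e.target ∩ e.symm ⁻¹' e.sourceᶜ = ∅ := by
    ext z
    simp only [Set.mem_inter_iff, Set.mem_preimage, Set.mem_compl_iff, Set.mem_empty_iff_false,
      iff_false, not_and, not_not]
    exact fun hz ↦ e.map_target hz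
  rw [this, Measure.restrict_empty, lintegral_zero_measure]

/-- The coordinate expressions of the volume agree on overlaps of charts. -/
theorem chartVolume_eq [IsManifold 𝓘(ℂ, CModel d) ω M] (K : KahlerForm d M)
    {e e' : OpenPartialHomeomorph M (CModel d)}
    (he : e ∈ atlas (CModel d) M) (he' : e' ∈ atlas (CModel d) M) {A : Set M}
    (hA : MeasurableSet A) (h1 : A ⊆ e.source) (h2 : A ⊆ e'.source) :
    K.chartVolume e A = K.chartVolume e' A := by
  rw [chartVolume_apply _ _ hA, chartVolume_apply _ _ hA]
  have him : e'.target ∩ e'.symm ⁻¹' A = (e' ∘ e.symm) '' (e.target ∩ e.symm ⁻¹' A) := by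
    ext w
    constructor
    · rintro ⟨hw, hwA⟩
      refine ⟨e (e'.symm w), ⟨e.map_source (h1 hwA), ?_⟩, ?_⟩
      · simpa [e.left_inv (h1 hwA)] using hwA
      · simp [e.left_inv (h1 hwA), e'.right_inv hw]
    · rintro ⟨z, ⟨hz, hzA⟩, rfl⟩
      refine ⟨e'.map_source (h2 hzA), ?_⟩
      simpa [e'.left_inv (h2 hzA)] using hzA
  have hinj : Set.InjOn (e' ∘ e.symm) (e.target ∩ e.symm ⁻¹' A) := by
    rintro z ⟨hz, hzA⟩ w ⟨hw, hwA⟩ hzw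
    exact e.symm.injOn hz hw (e'.injOn (h2 hzA) (h2 hwA) hzw)
  rw [him, lintegral_image_eq_lintegral_abs_det_fderiv_mul _ (measurableSet_target_inter e hA)
    (f' := fun z ↦ fderiv ℝ (e' ∘ e.symm) z)
    (fun z hz ↦ (K.formInChart_comp he he' hz.1 (h2 hz.2)).1.hasFDerivAt.hasFDerivWithinAt) hinj]
  refine setLIntegral_congr_fun (measurableSet_target_inter e hA) fun z hz ↦ ?_
  rw [K.density_comp he he' hz.1 (h2 hz.2), ENNReal.ofReal_mul (abs_nonneg _)]
  rfl

theorem exists_measure [IsManifold 𝓘(ℂ, CModel d) ω M] [CompactSpace M] (K : KahlerForm d M) :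
    ∃ ν : Measure M, ν ≤ K.volume ∧
      ∀ e ∈ atlas (CModel d) M, ν.restrict e.source = K.chartVolume e := by
  rcases isEmpty_or_nonempty M with hM | hM
  · exact ⟨0, bot_le, fun e _ ↦ by simp [Measure.eq_zero_of_isEmpty]⟩
  obtain ⟨t, htc, ht⟩ := countable_cover_nhds_of_sigmaCompact
    (f := fun x : M ↦ (chartAt (CModel d) x).source)
    (fun x ↦ (chartAt (CModel d) x).open_source.mem_nhds (mem_chart_source _ x))
  have htne : t.Nonempty := by
    by_contra h
    rw [Set.not_nonempty_iff_eq_empty] at h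
    rw [h, Set.biUnion_empty] at ht
    exact Set.empty_ne_univ ht
  obtain ⟨f, hf⟩ := htc.exists_eq_range htne
  set E : ℕ → OpenPartialHomeomorph M (CModel d) := fun n ↦ chartAt (CModel d) (f n)
  have hE : ∀ n, E n ∈ atlas (CModel d) M := fun n ↦ chart_mem_atlas _ _
  set D : ℕ → Set M := disjointed fun n ↦ (E n).source
  have hDm : ∀ n, MeasurableSet (D n) := fun n ↦
    MeasurableSet.disjointed (fun n ↦ (E n).open_source.measurableSet) n
  have hDs : ∀ n, D n ⊆ (E n).source := fun n ↦ disjointed_subset _ n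
  have hDd : Pairwise (Function.onFun Disjoint D) := disjoint_disjointed _
  have hDu : ⋃ n, D n = Set.univ := by
    rw [iUnion_disjointed, ← ht, hf, Set.biUnion_range]
  refine ⟨Measure.sum fun n ↦ (K.chartVolume (E n)).restrict (D n), ?_, fun e he ↦ ?_⟩
  · refine Measure.le_iff.2 fun A hA ↦ ?_
    rw [Measure.sum_apply _ hA]
    calc ∑' n, (K.chartVolume (E n)).restrict (D n) A
        ≤ ∑' n, K.volume (A ∩ D n) := by
          refine ENNReal.tsum_le_tsum fun n ↦ ?_
          rw [Measure.restrict_apply hA]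
          exact K.le_volume (hE n) _
      _ = K.volume A := by
          rw [← measure_iUnion (fun i j hij ↦ (hDd hij).mono Set.inter_subset_right
            Set.inter_subset_right) (fun n ↦ hA.inter (hDm n)), ← Set.inter_iUnion, hDu,
            Set.inter_univ]
  · ext A hA
    have hAe := hA.inter e.open_source.measurableSet
    rw [Measure.restrict_apply hA, Measure.sum_apply _ hAe]
    calc ∑' n, (K.chartVolume (E n)).restrict (D n) (A ∩ e.source)
        = ∑' n, K.chartVolume e (A ∩ e.source ∩ D n) := by
          refine tsum_congr fun n ↦ ?_
          rw [Measure.restrict_apply hAe]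
          exact K.chartVolume_eq (hE n) he (hAe.inter (hDm n))
            (Set.inter_subset_right.trans (hDs n))
            (Set.inter_subset_left.trans Set.inter_subset_right)
      _ = K.chartVolume e (A ∩ e.source) := by
          rw [← measure_iUnion (fun i j hij ↦ (hDd hij).mono Set.inter_subset_right
            Set.inter_subset_right) (fun n ↦ hAe.inter (hDm n)), ← Set.inter_iUnion, hDu,
            Set.inter_univ]
      _ = K.chartVolume e A := by
          refine measure_inter_conull ?_
          exact measure_mono_null (fun x hx ↦ hx) (K.chartVolume_compl_source e)

/-- On the domain of every chart, the volume measure is given by its coordinate expression. -/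
theorem volume_restrict_source [IsManifold 𝓘(ℂ, CModel d) ω M] [CompactSpace M]
    (K : KahlerForm d M) {e : OpenPartialHomeomorph M (CModel d)}
    (he : e ∈ atlas (CModel d) M) : K.volume.restrict e.source = K.chartVolume e := by
  obtain ⟨ν, hν, hν'⟩ := K.exists_measure
  have h : K.volume = ν := by
    refine le_antisymm (iSup₂_le fun e he ↦ ?_) hν
    rw [← hν' e he]
    exact Measure.restrict_le_self
  rw [h, hν' e he]

instance [IsManifold 𝓘(ℂ, CModel d) ω M] [CompactSpace M] (K : KahlerForm d M) :
    IsFiniteMeasure K.volume := by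
  have hloc : IsLocallyFiniteMeasure K.volume := by
    refine ⟨fun x ↦ ?_⟩
    set e := chartAt (CModel d) x
    have he : e ∈ atlas (CModel d) M := chart_mem_atlas _ _
    have hx : x ∈ e.source := mem_chart_source _ x
    obtain ⟨C, hCx, hCt, hC⟩ := local_compact_nhds (e.open_target.mem_nhds (e.map_source hx))
    obtain ⟨B, hB⟩ := hC.bddAbove_image ((K.continuousOn_density he).mono hCt)
    have hs : IsOpen (e.source ∩ e ⁻¹' interior C) := e.isOpen_inter_preimage isOpen_interior
    refine ⟨e.source ∩ e ⁻¹' interior C, hs.mem_nhds ⟨hx, mem_interior_iff_mem_nhds.2 hCx⟩, ?_⟩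
    have h1 : K.volume (e.source ∩ e ⁻¹' interior C) =
        K.chartVolume e (e.source ∩ e ⁻¹' interior C) := by
      rw [← K.volume_restrict_source he, Measure.restrict_apply hs.measurableSet,
        Set.inter_eq_left.2 Set.inter_subset_left]
    rw [h1, chartVolume_apply _ _ hs.measurableSet]
    have hsub : e.target ∩ e.symm ⁻¹' (e.source ∩ e ⁻¹' interior C) ⊆ C := by
      rintro z ⟨hz, -, hz'⟩
      rw [Set.mem_preimage, e.right_inv hz] at hz'
      exact interior_subset hz'
    refine setLIntegral_lt_top_of_le_nnreal
      ((measure_mono hsub).trans_lt hC.measure_lt_top).ne ⟨B.toNNReal, fun z hz ↦ ?_⟩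
    exact ENNReal.ofReal_le_ofReal (hB ⟨z, hsub hz, rfl⟩)
  exact ⟨isCompact_univ.measure_lt_top⟩

instance [IsManifold 𝓘(ℂ, CModel d) ω M] [CompactSpace M] (K : KahlerForm d M) :
    K.volume.IsOpenPosMeasure := by
  refine ⟨fun U hU ⟨x, hx⟩ ↦ ?_⟩
  set e := chartAt (CModel d) x
  have he : e ∈ atlas (CModel d) M := chart_mem_atlas _ _
  have hxe : x ∈ e.source := mem_chart_source _ x
  intro h0
  have h1 : K.chartVolume e U = 0 := le_antisymm (h0 ▸ K.le_volume he U) bot_le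
  have hO : IsOpen (e.target ∩ e.symm ⁻¹' U) := e.isOpen_inter_preimage_symm hU
  have hm : AEMeasurable (fun z ↦ ENNReal.ofReal (K.density e z))
      (MeasureTheory.volume.restrict (e.target ∩ e.symm ⁻¹' U)) :=
    (((K.continuousOn_density he).mono Set.inter_subset_left).aemeasurable
      hO.measurableSet).ennreal_ofReal
  rw [chartVolume_apply _ _ hU.measurableSet, setLIntegral_eq_zero_iff' hO.measurableSet hm] at h1
  have h2 : MeasureTheory.volume (e.target ∩ e.symm ⁻¹' U) = 0 := by
    refine measure_mono_null (fun z hz ↦ ?_) (ae_iff.1 h1)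
    simp only [Set.mem_ofPred_eq, Classical.not_imp]
    exact ⟨hz, (ENNReal.ofReal_pos.2 (K.density_pos he hz.1)).ne'⟩
  exact hO.measure_ne_zero _ ⟨e x, e.map_source hxe, by simpa [e.left_inv hxe] using hx⟩ h2

end KahlerForm

section Sections

variable {d : ℕ} {M : Type*} [TopologicalSpace M] [ChartedSpace (CModel d) M]
  {L : M → Type*} [TopologicalSpace (TotalSpace ℂ L)] [∀ x, AddCommGroup (L x)]
  [∀ x, Module ℂ (L x)] [∀ x, TopologicalSpace (L x)] [FiberBundle ℂ L] [VectorBundle ℂ ℂ L]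

/-- The space `H⁰(M, L)` of global holomorphic sections of the line bundle `L`. The Kähler form and
the Hermitian metric only serve to determine its inner product. -/
def HolSection (_K : KahlerForm d M) (_h : HermitianMetric d L) : Type _ :=
  ContMDiffSection 𝓘(ℂ, CModel d) ℂ ω L

namespace HolSection

variable {K : KahlerForm d M} {h : HermitianMetric d L}

noncomputable instance : AddCommGroup (HolSection K h) :=
  inferInstanceAs (AddCommGroup (ContMDiffSection 𝓘(ℂ, CModel d) ℂ ω L))

noncomputable instance : Module ℂ (HolSection K h) :=
  inferInstanceAs (Module ℂ (ContMDiffSection 𝓘(ℂ, CModel d) ℂ ω L))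

/-- The values of a section at all points of `M`, as a linear map. -/
noncomputable def eval : HolSection K h →ₗ[ℂ] ∀ x : M, L x where
  toFun s := ContMDiffSection.coeAddHom 𝓘(ℂ, CModel d) ℂ ω L s
  map_add' s t := map_add (ContMDiffSection.coeAddHom 𝓘(ℂ, CModel d) ℂ ω L) s t
  map_smul' _ _ := rfl

theorem eval_injective : Function.Injective (eval (K := K) (h := h)) :=
  ContMDiffSection.coe_injective

theorem contMDiffAt_eval (s : HolSection K h) (x₀ : M) :
    ContMDiffAt 𝓘(ℂ, CModel d) 𝓘(ℂ, ℂ) ω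
      (fun x ↦ (trivializationAt ℂ L x₀ ⟨x, eval s x⟩).2) x₀ :=
  contMDiffAt_section x₀ |>.1 (ContMDiffSection.contMDiff s x₀)

end HolSection

theorem HermitianMetric.continuous_inner (h : HermitianMetric d L) {K : KahlerForm d M}
    (s t : HolSection K h) : Continuous fun x ↦ h.inner x (s.eval x) (t.eval x) := by
  refine continuous_iff_continuousAt.2 fun x₀ ↦ ?_
  set e := trivializationAt ℂ L x₀
  have hx₀ : x₀ ∈ e.baseSet := mem_baseSet_trivializationAt ℂ L x₀
  have hs := (s.contMDiffAt_eval x₀).continuousAt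
  have ht := (t.contMDiffAt_eval x₀).continuousAt
  have hh := (h.smooth e).continuousOn.continuousAt (e.open_baseSet.mem_nhds hx₀)
  have key : ∀ x ∈ e.baseSet, ∀ v : L x, v = (e ⟨x, v⟩).2 • e.symm x (1 : ℂ) := by
    intro x hx v
    have h1 := e.symm_linearMapAt (R := ℂ) hx v
    rw [e.linearMapAt_apply, if_pos hx] at h1
    have h2 := (e.symmₗ ℂ x).map_smul (e ⟨x, v⟩).2 1
    rw [e.symmₗ_apply hx, e.symmₗ_apply hx, smul_eq_mul, mul_one, h1] at h2
    exact h2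
  have hcont : ContinuousAt (fun x ↦ conj (e ⟨x, s.eval x⟩).2 * ((e ⟨x, t.eval x⟩).2 *
      h.inner x (e.symm x 1) (e.symm x 1))) x₀ :=
    (Complex.continuous_conj.continuousAt.comp hs).mul (ht.mul hh)
  refine hcont.congr ?_
  filter_upwards [e.open_baseSet.mem_nhds hx₀] with x hx
  conv_rhs => rw [key x hx (s.eval x), key x hx (t.eval x)]
  simp only [map_smul, LinearMap.map_smulₛₗ, LinearMap.smul_apply, smul_eq_mul]
  ring

namespace HolSection

variable {K : KahlerForm d M} {h : HermitianMetric d L}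
  [MeasurableSpace M] [BorelSpace M] [CompactSpace M] [IsManifold 𝓘(ℂ, CModel d) ω M]

theorem integrable_inner (s t : HolSection K h) :
    Integrable (fun x ↦ h.inner x (s.eval x) (t.eval x)) K.volume :=
  (h.continuous_inner s t).integrable_of_hasCompactSupport (HasCompactSupport.of_compactSpace _)

/-- The `L²` inner product of holomorphic sections, `⟪s, t⟫ = ∫ h(s, t) ω ^ d / d!`. -/
@[reducible]
noncomputable def innerCore : InnerProductSpace.Core ℂ (HolSection K h) where
  inner s t := ∫ x, h.inner x (s.eval x) (t.eval x) ∂K.volume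
  conj_inner_symm s t := by
    rw [← integral_conj]
    exact integral_congr_ae (.of_forall fun x ↦ h.symm x _ _)
  re_inner_nonneg s := by
    have h1 := integral_re (𝕜 := ℂ) (s.integrable_inner s)
    refine h1 ▸ integral_nonneg fun x ↦ ?_
    by_cases hx : s.eval x = 0
    · simp [hx]
    · exact (h.pos x _ hx).le
  add_left s t u := by
    rw [← integral_add (s.integrable_inner u) (t.integrable_inner u)]
    simp
  smul_left s t c := by
    rw [← integral_const_mul]
    simp
  definite s hs := by
    have h1 := integral_re (𝕜 := ℂ) (s.integrable_inner s)
    have h0 : ∀ x, 0 ≤ RCLike.re (h.inner x (s.eval x) (s.eval x)) := by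
      intro x
      by_cases hx : s.eval x = 0
      · simp [hx]
      · exact (h.pos x _ hx).le
    have hc : Continuous fun x ↦ RCLike.re (h.inner x (s.eval x) (s.eval x)) :=
      RCLike.continuous_re.comp (h.continuous_inner s s)
    have h2 : ∫ x, RCLike.re (h.inner x (s.eval x) (s.eval x)) ∂K.volume = 0 := by
      rw [h1]
      exact (congrArg RCLike.re hs).trans (map_zero _)
    have h3 := (integral_eq_zero_iff_of_nonneg h0 (s.integrable_inner s).re).1 h2
    have h4 := Measure.eq_of_ae_eq h3 hc continuous_const
    refine eval_injective (funext fun x ↦ ?_)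
    rw [map_zero]
    by_contra hx
    exact (h.pos x _ hx).ne' (congrFun h4 x)

noncomputable instance : NormedAddCommGroup (HolSection K h) :=
  innerCore.toNormedAddCommGroup

noncomputable instance : InnerProductSpace ℂ (HolSection K h) :=
  InnerProductSpace.ofCore innerCore.toCore

theorem inner_def (s t : HolSection K h) :
    inner ℂ s t = ∫ x, h.inner x (s.eval x) (t.eval x) ∂K.volume := rfl

end HolSection

end Sections

section ExternalProduct

variable {d₁ d₂ : ℕ}
  {M₁ : Type*} [TopologicalSpace M₁] [ChartedSpace (CModel d₁) M₁]
  {M₂ : Type*} [TopologicalSpace M₂] [ChartedSpace (CModel d₂) M₂]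
  {L₁ : M₁ → Type*} [TopologicalSpace (TotalSpace ℂ L₁)] [∀ x, AddCommGroup (L₁ x)]
  [∀ x, Module ℂ (L₁ x)] [∀ x, TopologicalSpace (L₁ x)] [FiberBundle ℂ L₁] [VectorBundle ℂ ℂ L₁]
  {L₂ : M₂ → Type*} [TopologicalSpace (TotalSpace ℂ L₂)] [∀ x, AddCommGroup (L₂ x)]
  [∀ x, Module ℂ (L₂ x)] [∀ x, TopologicalSpace (L₂ x)] [FiberBundle ℂ L₂] [VectorBundle ℂ ℂ L₂]

/-- The trivialization of the line bundle `L₁ ⊠ L₂`, with fibre `L₁ x ⊗ L₂ y` over `(x, y)`,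
induced by local trivializations of `L₁` and `L₂`. -/
noncomputable def boxCoord (e₁ : Trivialization ℂ (π ℂ L₁)) [MemTrivializationAtlas e₁]
    (e₂ : Trivialization ℂ (π ℂ L₂)) [MemTrivializationAtlas e₂] (p : M₁ × M₂) :
    L₁ p.1 ⊗[ℂ] L₂ p.2 →ₗ[ℂ] ℂ :=
  (TensorProduct.lid ℂ ℂ).toLinearMap ∘ₗ
    TensorProduct.map (e₁.linearMapAt ℂ p.1) (e₂.linearMapAt ℂ p.2)

variable (d₁ d₂ L₁ L₂) in
/-- The space `H⁰(M₁ × M₂, L₁ ⊠ L₂)` of global holomorphic sections: families of elements of the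
fibres which are holomorphic in the local trivializations of `L₁ ⊠ L₂`. -/
noncomputable def BoxSection : Submodule ℂ (∀ p : M₁ × M₂, L₁ p.1 ⊗[ℂ] L₂ p.2) where
  carrier := {s | ∀ (e₁ : Trivialization ℂ (π ℂ L₁)) [MemTrivializationAtlas e₁]
    (e₂ : Trivialization ℂ (π ℂ L₂)) [MemTrivializationAtlas e₂],
    ContMDiffOn (𝓘(ℂ, CModel d₁).prod 𝓘(ℂ, CModel d₂)) 𝓘(ℂ, ℂ) ω
      (fun p ↦ boxCoord e₁ e₂ p (s p)) (e₁.baseSet ×ˢ e₂.baseSet)}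
  add_mem' hs ht e₁ _ e₂ _ := by
    exact ((hs e₁ e₂).add (ht e₁ e₂)).congr fun p _ ↦ map_add _ _ _
  zero_mem' e₁ _ e₂ _ := by
    exact (contMDiffOn_const (c := (0 : ℂ))).congr fun p _ ↦ map_zero _
  smul_mem' c s hs e₁ _ e₂ _ := by
    exact (ContMDiffOn.mul (contMDiffOn_const (c := c)) (hs e₁ e₂)).congr fun p _ ↦
      (boxCoord e₁ e₂ p).map_smul c (s p)

/-- The map `R_Λ` restricting holomorphic sections of `L₁ ⊠ L₂` to a subset `Λ` of `M₁ × M₂`, with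
values in the space of arbitrary sections over `Λ`. -/
noncomputable def BoxSection.restrict (Λ : Set (M₁ × M₂)) :
    BoxSection d₁ d₂ L₁ L₂ →ₗ[ℂ] ∀ p : Λ, L₁ p.1.1 ⊗[ℂ] L₂ p.1.2 where
  toFun s p := s.1 p.1
  map_add' _ _ := rfl
  map_smul' _ _ := rfl

/-- The map `R_Λ` restricting holomorphic sections of a line bundle on `M` to a subset `Λ` of `M`,
with values in the space of arbitrary sections over `Λ`. -/
noncomputable def HolSection.restrict {K : KahlerForm d₁ M₁} {h : HermitianMetric d₁ L₁}
    (Λ : Set M₁) : HolSection K h →ₗ[ℂ] ∀ x : Λ, L₁ x.1 where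
  toFun s x := s.eval x.1
  map_add' s t := by rw [map_add]; rfl
  map_smul' c s := by rw [map_smul]; rfl

theorem HolSection.contMDiffOn_linearMapAt [ContMDiffVectorBundle ω ℂ L₁ 𝓘(ℂ, CModel d₁)]
    {K : KahlerForm d₁ M₁} {h : HermitianMetric d₁ L₁} (s : HolSection K h)
    (e : Trivialization ℂ (π ℂ L₁)) [MemTrivializationAtlas e] :
    ContMDiffOn 𝓘(ℂ, CModel d₁) 𝓘(ℂ, ℂ) ω (fun x ↦ e.linearMapAt ℂ x (s.eval x)) e.baseSet := by
  refine ((e.contMDiffOn_section_baseSet_iff (IB := 𝓘(ℂ, CModel d₁)) (n := ω)).1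
    (ContMDiffSection.contMDiff s).contMDiffOn).congr fun x hx ↦ ?_
  rw [e.linearMapAt_apply, if_pos hx]
  rfl

variable [ContMDiffVectorBundle ω ℂ L₁ 𝓘(ℂ, CModel d₁)] [ContMDiffVectorBundle ω ℂ L₂ 𝓘(ℂ, CModel d₂)]
  {K₁ : KahlerForm d₁ M₁} {h₁ : HermitianMetric d₁ L₁}
  {K₂ : KahlerForm d₂ M₂} {h₂ : HermitianMetric d₂ L₂}

/-- The canonical map `H⁰(M₁, L₁) ⊗ H⁰(M₂, L₂) → H⁰(M₁ × M₂, L₁ ⊠ L₂)`, which sends `u ⊗ v` to the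
section `(x, y) ↦ u x ⊗ v y`. -/
noncomputable def boxMap :
    HolSection K₁ h₁ ⊗[ℂ] HolSection K₂ h₂ →ₗ[ℂ] BoxSection d₁ d₂ L₁ L₂ :=
  TensorProduct.lift <| LinearMap.mk₂ ℂ
    (fun u v ↦ ⟨fun p ↦ u.eval p.1 ⊗ₜ[ℂ] v.eval p.2, fun e₁ _ e₂ _ ↦ by
      have h1 := (u.contMDiffOn_linearMapAt e₁).comp
        (contMDiffOn_fst (J := 𝓘(ℂ, CModel d₂)) (N := M₂) (s := e₁.baseSet ×ˢ e₂.baseSet))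
        fun p hp ↦ hp.1
      have h2 := (v.contMDiffOn_linearMapAt e₂).comp
        (contMDiffOn_snd (I := 𝓘(ℂ, CModel d₁)) (M := M₁) (s := e₁.baseSet ×ˢ e₂.baseSet))
        fun p hp ↦ hp.2
      exact h1.mul h2⟩)
    (fun u u' v ↦ Subtype.ext <| funext fun p ↦ by
      simp [TensorProduct.add_tmul])
    (fun c u v ↦ Subtype.ext <| funext fun p ↦ by
      simp [TensorProduct.smul_tmul'])
    (fun u v v' ↦ Subtype.ext <| funext fun p ↦ by
      simp [TensorProduct.tmul_add])
    (fun c u v ↦ Subtype.ext <| funext fun p ↦ by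
      simp)

/-- The kernel of `R_Λ`, for a subset `Λ` of `M₁ × M₂`, as a subspace of
`H⁰(M₁, L₁) ⊗ H⁰(M₂, L₂)`, which is identified with `H⁰(M₁ × M₂, L₁ ⊠ L₂)` by `boxMap`. -/
noncomputable def boxKer (K₁ : KahlerForm d₁ M₁) (h₁ : HermitianMetric d₁ L₁)
    (K₂ : KahlerForm d₂ M₂) (h₂ : HermitianMetric d₂ L₂) (Λ : Set (M₁ × M₂)) :
    Submodule ℂ (HolSection K₁ h₁ ⊗[ℂ] HolSection K₂ h₂) :=
  LinearMap.ker (BoxSection.restrict Λ ∘ₗ boxMap)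

end ExternalProduct

/-- For subspaces `V ⊆ A` and `W ⊆ B`, the tensor product `V ⊗ W` as a subspace of `A ⊗ B`. -/
noncomputable def tensorSubspace {A B : Type*} [AddCommGroup A] [Module ℂ A] [AddCommGroup B]
    [Module ℂ B] (V : Submodule ℂ A) (W : Submodule ℂ B) : Submodule ℂ (A ⊗[ℂ] B) :=
  LinearMap.range (TensorProduct.mapIncl V W)

/-! ### Jointly injective families of linear maps and their tensor products. -/

section JointInjectivity

variable {A B : Type*} [AddCommGroup A] [Module ℂ A] [AddCommGroup B] [Module ℂ B]
  {ι κ : Type*} {P : ι → Type*} [∀ i, AddCommGroup (P i)] [∀ i, Module ℂ (P i)]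
  {Q : κ → Type*} [∀ j, AddCommGroup (Q j)] [∀ j, Module ℂ (Q j)]

/-! Write `N₁`, `N₂` for the kernels of restriction to `Λ₁` and `Λ₂`. A tensor `t` restricts to zero
on `Λ₁ ×ˢ Λ₂` exactly when `ev_x ⊗ ev_y` kills it for all `x ∈ Λ₁`, `y ∈ Λ₂`, so the problem is
linear algebra of evaluation maps. The whole space is the orthogonal sum of `H_A ⊗ N₂`, `N₁ ⊗ N₂ᗮ`
and `N₁ᗮ ⊗ N₂ᗮ`. The first two lie in the kernel because one factor always vanishes
(`tensorSubspace_le_boxKer`). The third meets it trivially: evaluations at points of `Λⱼ` are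
jointly injective on `Nⱼᗮ`, and over a field joint injectivity passes to tensor products
(`disjoint_boxKer_tensorSubspace`). Hence the kernel is the sum of the first two, and its orthogonal
complement is the third.

The orthogonal decompositions rest on finite-dimensionality of the spaces of sections
(`HolSection.finiteDimensional`), obtained from the Schwarz lemma and compactness: finitely many
points already determine a section.

Injectivity of `boxMap` is joint injectivity once more, now with all points. For surjectivity, each
slice `s(x, ·)` is expanded in a basis of `H_B`; the coefficients are holomorphic in `x` because
point evaluations span the dual of `H_B` (`BoxSection.exists_dual_slice`). -/

theorem TensorProduct.eq_zero_of_forall_rTensor_eq_zero {a : ∀ i, A →ₗ[ℂ] P i}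
    (ha : ∀ x, (∀ i, a i x = 0) → x = 0) {t : A ⊗[ℂ] B}
    (ht : ∀ i, (a i).rTensor B t = 0) : t = 0 := by
  classical
  let 𝒞 := Module.Basis.ofVectorSpace ℂ B
  -- In a basis of `B` a tensor becomes a finite family of coefficients in `A`, on which `(a
  -- i).rTensor B` acts entry by entry; joint injectivity then kills each coefficient.
  have key : ∀ i k (u : A ⊗[ℂ] B), a i (equivFinsuppOfBasisRight 𝒞 u k) =
      equivFinsuppOfBasisRight 𝒞 ((a i).rTensor B u) k := by
    intro i k u
    induction u with
    | zero => simp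
    | tmul x y => simp
    | add x y hx hy => simp only [map_add, Finsupp.add_apply, hx, hy]
  refine (equivFinsuppOfBasisRight 𝒞).map_eq_zero_iff.1 (Finsupp.ext fun k ↦ ha _ fun i ↦ ?_)
  rw [key, ht, map_zero, Finsupp.zero_apply]

theorem TensorProduct.eq_zero_of_forall_lTensor_eq_zero {b : ∀ j, B →ₗ[ℂ] Q j}
    (hb : ∀ y, (∀ j, b j y = 0) → y = 0) {t : A ⊗[ℂ] B}
    (ht : ∀ j, (b j).lTensor A t = 0) : t = 0 := by
  refine (TensorProduct.comm ℂ A B).map_eq_zero_iff.1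
    (eq_zero_of_forall_rTensor_eq_zero hb fun j ↦ ?_)
  rw [LinearMap.rTensor, TensorProduct.map_comm]
  exact (congrArg _ (ht j)).trans (map_zero _)

/-- Over a field, tensor products of two jointly injective families of linear maps are jointly
injective. -/
theorem TensorProduct.eq_zero_of_forall_map_eq_zero {a : ∀ i, A →ₗ[ℂ] P i}
    {b : ∀ j, B →ₗ[ℂ] Q j} (ha : ∀ x, (∀ i, a i x = 0) → x = 0)
    (hb : ∀ y, (∀ j, b j y = 0) → y = 0) {t : A ⊗[ℂ] B}
    (ht : ∀ i j, TensorProduct.map (a i) (b j) t = 0) : t = 0 := by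
  -- Since `map (a i) (b j)` applies `a i` and then `b j`, the family `b` first kills `(a i).rTensor
  -- B t` for each fixed `i`; the family `a` then kills `t`.
  refine eq_zero_of_forall_rTensor_eq_zero ha fun i ↦
    eq_zero_of_forall_lTensor_eq_zero hb fun j ↦ ?_
  rw [← LinearMap.comp_apply, LinearMap.lTensor_comp_rTensor, ht]

end JointInjectivity

/-! ### Orthogonality and spanning for tensor products of subspaces. -/

section TensorSubspace

theorem tensorSubspace_eq_map₂ {A B : Type*} [AddCommGroup A] [Module ℂ A] [AddCommGroup B]
    [Module ℂ B] (V : Submodule ℂ A) (W : Submodule ℂ B) :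
    tensorSubspace V W = Submodule.map₂ (TensorProduct.mk ℂ A B) V W := by
  rw [tensorSubspace, TensorProduct.range_mapIncl]

variable {A B : Type*} [NormedAddCommGroup A] [InnerProductSpace ℂ A]
  [NormedAddCommGroup B] [InnerProductSpace ℂ B]

theorem tensorSubspace_isOrtho {V V' : Submodule ℂ A} {W W' : Submodule ℂ B}
    (h : V ⟂ V' ∨ W ⟂ W') : tensorSubspace V W ⟂ tensorSubspace V' W' := by
  rw [tensorSubspace_eq_map₂, tensorSubspace_eq_map₂, Submodule.map₂_eq_span_image2,
    Submodule.map₂_eq_span_image2, Submodule.isOrtho_span]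
  rintro _ ⟨a, ha, b, hb, rfl⟩ _ ⟨a', ha', b', hb', rfl⟩
  refine (TensorProduct.inner_tmul ℂ a a' b b').trans ?_
  rcases h with h | h
  · rw [Submodule.isOrtho_iff_inner_eq.1 h a ha a' ha', zero_mul]
  · rw [Submodule.isOrtho_iff_inner_eq.1 h b hb b' hb', mul_zero]

/-- The last two terms share the factor `N'ᗮ` and add up to `A ⊗ N'ᗮ`, which together with `A ⊗ N'`
fills everything. -/
theorem tensorSubspace_sup_eq_top [FiniteDimensional ℂ A] [FiniteDimensional ℂ B]
    (N : Submodule ℂ A) (N' : Submodule ℂ B) :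
    tensorSubspace ⊤ N' ⊔ tensorSubspace N N'ᗮ ⊔ tensorSubspace Nᗮ N'ᗮ = ⊤ := by
  simp only [tensorSubspace_eq_map₂]
  rw [sup_assoc, ← Submodule.map₂_sup_left, Submodule.sup_orthogonal_of_hasOrthogonalProjection,
    ← Submodule.map₂_sup_right, Submodule.sup_orthogonal_of_hasOrthogonalProjection,
    TensorProduct.map₂_mk_top_top_eq_top]

/-- If `C` is an orthogonal complement of `P` and meets `Q ≥ P` trivially, then `Q = P` and
`Qᗮ = C`. -/
theorem Submodule.eq_and_orthogonal_eq_of_isOrtho {E : Type*} [NormedAddCommGroup E]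
    [InnerProductSpace ℂ E] {P Q C : Submodule ℂ E} (hPQ : P ≤ Q) (hPC : P ⟂ C)
    (hQC : Disjoint Q C) (htop : P ⊔ C = ⊤) : Q = P ∧ Qᗮ = C := by
  have hQ : Q = P := by
    refine le_antisymm (fun x hx ↦ ?_) hPQ
    obtain ⟨p, hp, c, hc, rfl⟩ := Submodule.mem_sup.1 (htop ▸ Submodule.mem_top : x ∈ P ⊔ C)
    have hcQ : c ∈ Q := by simpa using Q.sub_mem hx (hPQ hp)
    rw [Submodule.disjoint_def.1 hQC c hcQ hc, add_zero]
    exact hp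
  refine ⟨hQ, hQ ▸ le_antisymm (fun x hx ↦ ?_) hPC.symm.le⟩
  obtain ⟨p, hp, c, hc, rfl⟩ := Submodule.mem_sup.1 (htop ▸ Submodule.mem_top : x ∈ P ⊔ C)
  have hpo : p ∈ Pᗮ := by simpa using Pᗮ.sub_mem hx (hPC.symm.le hc)
  rw [Submodule.disjoint_def.1 P.orthogonal_disjoint p hp hpo, zero_add]
  exact hc

end TensorSubspace

/-! ### Finite-dimensionality of the space of holomorphic sections. -/

section LineBundle

variable {d : ℕ} {M : Type*} [TopologicalSpace M] [ChartedSpace (CModel d) M]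
  {L : M → Type*} [TopologicalSpace (TotalSpace ℂ L)] [∀ x, AddCommGroup (L x)]
  [∀ x, Module ℂ (L x)] [∀ x, TopologicalSpace (L x)] [FiberBundle ℂ L] [VectorBundle ℂ ℂ L]

theorem linearMapAt_smul_symm_one (e : Trivialization ℂ (π ℂ L)) [MemTrivializationAtlas e]
    {x : M} (hx : x ∈ e.baseSet) (v : L x) :
    e.linearMapAt ℂ x v • e.symm x (1 : ℂ) = v := by
  have h1 := e.symmₗ_linearMapAt (R := ℂ) hx v
  have h2 := (e.symmₗ ℂ x).map_smul (e.linearMapAt ℂ x v) 1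
  rw [smul_eq_mul, mul_one, h1, e.symmₗ_apply hx] at h2
  exact h2.symm

instance finiteDimensional_fibre (x : M) : FiniteDimensional ℂ (L x) :=
  Module.Finite.equiv
    ((trivializationAt ℂ L x).linearEquivAt ℂ x (mem_baseSet_trivializationAt ℂ L x)).symm

/-- Reduces estimates of the fibre norm to the modulus of a scalar coordinate function, which is
what the Schwarz lemma controls. -/
theorem HermitianMetric.re_inner_eq (h : HermitianMetric d L)
    (e : Trivialization ℂ (π ℂ L)) [MemTrivializationAtlas e] {x : M} (hx : x ∈ e.baseSet)
    (v : L x) : (h.inner x v v).re =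
      (h.inner x (e.symm x 1) (e.symm x 1)).re * ‖e.linearMapAt ℂ x v‖ ^ 2 := by
  conv_lhs => rw [← linearMapAt_smul_symm_one e hx v]
  simp only [map_smul, LinearMap.map_smulₛₗ, LinearMap.smul_apply, smul_eq_mul]
  rw [← mul_assoc, Complex.mul_conj, Complex.re_ofReal_mul, Complex.normSq_eq_norm_sq, mul_comm]

theorem HermitianMetric.re_inner_symm_one_pos (h : HermitianMetric d L)
    (e : Trivialization ℂ (π ℂ L)) [MemTrivializationAtlas e] {x : M} (hx : x ∈ e.baseSet) :
    0 < (h.inner x (e.symm x 1) (e.symm x 1)).re := by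
  refine h.pos x _ fun h0 ↦ ?_
  have := e.linearMapAt_symm (R := ℂ) hx 1
  simp [h0] at this

variable [IsManifold 𝓘(ℂ, CModel d) ω M] [ContMDiffVectorBundle ω ℂ L 𝓘(ℂ, CModel d)]
  {K : KahlerForm d M} {h : HermitianMetric d L}

/-- Near a zero of a holomorphic section its squared norm is at most half of the maximum, on a
neighbourhood which does not depend on the section. -/
theorem HolSection.exists_nhds_re_inner_le (K : KahlerForm d M) (h : HermitianMetric d L)
    (x₀ : M) : ∃ U ∈ nhds x₀, ∀ s : HolSection K h, s.eval x₀ = 0 → ∀ S : ℝ,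
      (∀ x, (h.inner x (s.eval x) (s.eval x)).re ≤ S) →
      ∀ x ∈ U, (h.inner x (s.eval x) (s.eval x)).re ≤ S / 2 := by
  set e := trivializationAt ℂ L x₀
  set c := chartAt (CModel d) x₀
  have hx₀ : x₀ ∈ e.baseSet := mem_baseSet_trivializationAt ℂ L x₀
  have hc₀ : x₀ ∈ c.source := mem_chart_source _ x₀
  set g : M → ℝ := fun x ↦ (h.inner x (e.symm x 1) (e.symm x 1)).re
  have hg : ContinuousAt g x₀ := Complex.continuous_re.continuousAt.comp
    ((h.smooth e).continuousOn.continuousAt (e.open_baseSet.mem_nhds hx₀))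
  have hg0 : 0 < g x₀ := h.re_inner_symm_one_pos e hx₀
  -- Here the squared norm `g` of the frame stays within a factor 2 of `g x₀`, so passing between
  -- fibre norm and coordinate costs at most a factor 4 in total.
  have hW : {x | x ∈ e.baseSet ∧ g x₀ / 2 < g x ∧ g x < 2 * g x₀} ∈ nhds x₀ := by
    filter_upwards [e.open_baseSet.mem_nhds hx₀, hg.eventually_const_lt (half_lt_self hg0),
      hg.eventually_lt_const (by linarith : g x₀ < 2 * g x₀)] with x h1 h2 h3 using ⟨h1, h2, h3⟩
  obtain ⟨R, hR, hRb⟩ := Metric.mem_nhds_iff.1 (Filter.inter_mem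
    (c.open_target.mem_nhds (c.map_source hc₀))
    ((c.continuousAt_symm (c.map_source hc₀)).preimage_mem_nhds
      ((c.left_inv hc₀).symm ▸ hW)))
  rw [c.left_inv hc₀] at hRb
  -- On the ball of radius `R / 4` the Schwarz lemma gains a factor 4, hence 16 after squaring.
  -- Against the loss of 4 from the frame this leaves `S / 4`, below the required `S / 2`.
  refine ⟨c.source ∩ c ⁻¹' Metric.ball (c x₀) (R / 4),
    (c.isOpen_inter_preimage Metric.isOpen_ball).mem_nhds
      ⟨hc₀, Metric.mem_ball_self (by positivity)⟩, fun s hs S hS x hx ↦ ?_⟩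
  have hS0 : 0 ≤ S := by simpa [hs] using hS x₀
  set f : CModel d → ℂ := fun z ↦ e.linearMapAt ℂ (c.symm z) (s.eval (c.symm z))
  have hfd : DifferentiableOn ℂ f (Metric.ball (c x₀) R) := by
    have h1 : ContMDiffOn 𝓘(ℂ, CModel d) 𝓘(ℂ, ℂ) ω f (Metric.ball (c x₀) R) :=
      (s.contMDiffOn_linearMapAt e).comp
        ((contMDiffOn_chart_symm (I := 𝓘(ℂ, CModel d)) (n := ω) (x := x₀)).mono
          fun z hz ↦ (hRb hz).1) fun z hz ↦ (hRb hz).2.1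
    exact (contMDiffOn_iff_contDiffOn.1 h1).differentiableOn (by simp)
  have hf0 : f (c x₀) = 0 := by
    simp only [f]
    rw [c.left_inv hc₀, hs, map_zero]
  have hfb : Set.MapsTo f (Metric.ball (c x₀) R)
      (Metric.closedBall (f (c x₀)) √(S / (g x₀ / 2))) := by
    intro z hz
    rw [hf0, mem_closedBall_zero_iff]
    refine Real.le_sqrt_of_sq_le ((le_div_iff₀' (half_pos hg0)).2 ?_)
    have h1 := hS (c.symm z)
    rw [h.re_inner_eq e (hRb hz).2.1] at h1
    exact (mul_le_mul_of_nonneg_right (hRb hz).2.2.1.le (sq_nonneg _)).trans h1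
  have hz : c x ∈ Metric.ball (c x₀) R := Metric.ball_subset_ball (by linarith) hx.2
  -- Schwarz lemma for `f`, which vanishes at the centre `c x₀`.
  have h1 := Complex.dist_le_div_mul_dist_of_mapsTo_ball hfd hfb hz
  have h2 : ‖f (c x)‖ ≤ √(S / (g x₀ / 2)) / 4 := by
    rw [hf0, dist_zero_right] at h1
    refine h1.trans ?_
    have h3 : dist (c x) (c x₀) ≤ R / 4 := (Metric.mem_ball.1 hx.2).le
    calc _ ≤ √(S / (g x₀ / 2)) / R * (R / 4) := by gcongr
      _ = _ := by field_simp
  have h4 := (hRb hz).2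
  have h5 : ‖f (c x)‖ = ‖e.linearMapAt ℂ x (s.eval x)‖ := by
    simp only [f]
    rw [c.left_inv hx.1]
  rw [h5] at h2
  rw [Set.mem_preimage, c.left_inv hx.1] at h4
  rw [h.re_inner_eq e h4.1]
  calc g x * ‖e.linearMapAt ℂ x (s.eval x)‖ ^ 2
      ≤ (2 * g x₀) * (√(S / (g x₀ / 2)) / 4) ^ 2 := by gcongr; exact h4.2.2.le
    _ = S / 4 := by
      rw [div_pow, Real.sq_sqrt (by positivity)]
      field_simp
      ring
    _ ≤ S / 2 := by linarith

/-- On a compact manifold, a holomorphic section is determined by its values at suitable finitely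
many points. -/
theorem HolSection.exists_finset_eval_injective [CompactSpace M] (K : KahlerForm d M)
    (h : HermitianMetric d L) :
    ∃ F : Finset M, ∀ s : HolSection K h, (∀ x ∈ F, s.eval x = 0) → s = 0 := by
  -- The neighbourhoods do not depend on the section, so one finite subcover serves all sections at
  -- once.
  choose U hU hUs using HolSection.exists_nhds_re_inner_le K h
  obtain ⟨F, hF⟩ := finite_cover_nhds hU
  refine ⟨F, fun s hs ↦ eval_injective (funext fun x ↦ ?_)⟩
  have : Nonempty M := ⟨x⟩
  obtain ⟨m, hm⟩ := (Complex.continuous_re.comp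
    (h.continuous_inner s s)).exists_forall_ge_of_hasCompactSupport
      (HasCompactSupport.of_compactSpace _)
  obtain ⟨p, hp, hmp⟩ : ∃ p ∈ F, m ∈ U p := by simpa using hF.ge (Set.mem_univ m)
  -- With `S` the maximum of the squared norm, attained at `m`, this reads `S ≤ S / 2`; a nonzero
  -- value at `x` would force `S > 0`.
  have h1 := hUs p s (hs p hp) _ hm m hmp
  rw [map_zero]
  by_contra hx
  have h2 := h.pos x _ hx
  have h3 := hm x
  simp only [Function.comp_apply] at h1 h3
  linarith

theorem HolSection.finiteDimensional [CompactSpace M] (K : KahlerForm d M)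
    (h : HermitianMetric d L) : FiniteDimensional ℂ (HolSection K h) := by
  obtain ⟨F, hF⟩ := HolSection.exists_finset_eval_injective K h
  refine Module.Finite.of_injective (LinearMap.pi fun x : F ↦ LinearMap.proj x.1 ∘ₗ eval)
    ((injective_iff_map_eq_zero _).2 fun s hs ↦ hF s fun x hx ↦ congrFun hs ⟨x, hx⟩)

end LineBundle

/-! ### Contraction of tensors with linear forms. -/

section Contraction

variable {V W : Type*} [AddCommGroup V] [Module ℂ V] [AddCommGroup W] [Module ℂ W]

/-- Contraction of the right factor of `V ⊗ W` with a linear form on `W`. -/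
noncomputable def contractRightFactor (ξ : Module.Dual ℂ W) : V ⊗[ℂ] W →ₗ[ℂ] V :=
  (TensorProduct.rid ℂ V).toLinearMap ∘ₗ ξ.lTensor V

/-- Contraction of the left factor of `V ⊗ W` with a linear form on `V`. -/
noncomputable def contractLeftFactor (η : Module.Dual ℂ V) : V ⊗[ℂ] W →ₗ[ℂ] W :=
  (TensorProduct.lid ℂ W).toLinearMap ∘ₗ η.rTensor W

@[simp]
theorem contractRightFactor_tmul (ξ : Module.Dual ℂ W) (v : V) (w : W) :
    contractRightFactor ξ (v ⊗ₜ[ℂ] w) = ξ w • v := by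
  simp [contractRightFactor]

@[simp]
theorem contractLeftFactor_tmul (η : Module.Dual ℂ V) (v : V) (w : W) :
    contractLeftFactor η (v ⊗ₜ[ℂ] w) = η v • w := by
  simp [contractLeftFactor]

/-- The two factors may be contracted in either order; this relates slices in the two variables. -/
theorem dual_contractRightFactor (η : Module.Dual ℂ V) (ξ : Module.Dual ℂ W) (τ : V ⊗[ℂ] W) :
    η (contractRightFactor ξ τ) = ξ (contractLeftFactor η τ) := by
  induction τ with
  | zero => simp
  | tmul v w => simp [mul_comm]
  | add x y hx hy => simp only [map_add, hx, hy]

theorem eq_of_forall_contractLeftFactor_eq {τ τ' : V ⊗[ℂ] W}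
    (h : ∀ η : Module.Dual ℂ V, contractLeftFactor η τ = contractLeftFactor η τ') : τ = τ' := by
  refine sub_eq_zero.1 (TensorProduct.eq_zero_of_forall_rTensor_eq_zero
    (a := fun η : Module.Dual ℂ V ↦ η)
    (fun x hx ↦ (Module.forall_dual_apply_eq_zero_iff ℂ x).1 hx) fun η ↦ ?_)
  refine (TensorProduct.lid ℂ W).map_eq_zero_iff.1 ?_
  exact ((contractLeftFactor η).map_sub τ τ').trans (sub_eq_zero.2 (h η))

end Contraction

/-! ### Slices of sections of the external product. -/

section ExternalProduct

variable {d₁ d₂ : ℕ}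
  {M₁ : Type*} [TopologicalSpace M₁] [ChartedSpace (CModel d₁) M₁]
  {M₂ : Type*} [TopologicalSpace M₂] [ChartedSpace (CModel d₂) M₂]
  {L₁ : M₁ → Type*} [TopologicalSpace (TotalSpace ℂ L₁)] [∀ x, AddCommGroup (L₁ x)]
  [∀ x, Module ℂ (L₁ x)] [∀ x, TopologicalSpace (L₁ x)] [FiberBundle ℂ L₁] [VectorBundle ℂ ℂ L₁]
  {L₂ : M₂ → Type*} [TopologicalSpace (TotalSpace ℂ L₂)] [∀ x, AddCommGroup (L₂ x)]
  [∀ x, Module ℂ (L₂ x)] [∀ x, TopologicalSpace (L₂ x)] [FiberBundle ℂ L₂] [VectorBundle ℂ ℂ L₂]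

theorem dual_eq_linearMapAt_mul (e : Trivialization ℂ (π ℂ L₁)) [MemTrivializationAtlas e]
    {x : M₁} (hx : x ∈ e.baseSet) (ξ : Module.Dual ℂ (L₁ x)) (v : L₁ x) :
    ξ v = e.linearMapAt ℂ x v * ξ (e.symm x 1) := by
  conv_lhs => rw [← linearMapAt_smul_symm_one e hx v]
  rw [map_smul, smul_eq_mul]

/-- In local frames, contraction multiplies the coordinate by the value of `ξ` on the frame. With
the second variable fixed this factor is constant, so slices inherit holomorphy. -/
theorem linearMapAt_contractRightFactor (e₁ : Trivialization ℂ (π ℂ L₁)) [MemTrivializationAtlas e₁]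
    (e₂ : Trivialization ℂ (π ℂ L₂)) [MemTrivializationAtlas e₂] (p : M₁ × M₂)
    (hp : p.2 ∈ e₂.baseSet) (ξ : Module.Dual ℂ (L₂ p.2)) (τ : L₁ p.1 ⊗[ℂ] L₂ p.2) :
    e₁.linearMapAt ℂ p.1 (contractRightFactor ξ τ) = ξ (e₂.symm p.2 1) * boxCoord e₁ e₂ p τ := by
  induction τ with
  | zero => simp
  | tmul v w =>
    rw [contractRightFactor_tmul, map_smul, smul_eq_mul, dual_eq_linearMapAt_mul e₂ hp ξ w]
    simp only [boxCoord, LinearMap.comp_apply, TensorProduct.map_tmul, LinearEquiv.coe_coe,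
      TensorProduct.lid_tmul, smul_eq_mul]
    ring
  | add x y hx hy => simp only [map_add, hx, hy, mul_add]

theorem linearMapAt_contractLeftFactor (e₁ : Trivialization ℂ (π ℂ L₁)) [MemTrivializationAtlas e₁]
    (e₂ : Trivialization ℂ (π ℂ L₂)) [MemTrivializationAtlas e₂] (p : M₁ × M₂)
    (hp : p.1 ∈ e₁.baseSet) (η : Module.Dual ℂ (L₁ p.1)) (τ : L₁ p.1 ⊗[ℂ] L₂ p.2) :
    e₂.linearMapAt ℂ p.2 (contractLeftFactor η τ) = η (e₁.symm p.1 1) * boxCoord e₁ e₂ p τ := by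
  induction τ with
  | zero => simp
  | tmul v w =>
    rw [contractLeftFactor_tmul, map_smul, smul_eq_mul, dual_eq_linearMapAt_mul e₁ hp η v]
    simp only [boxCoord, LinearMap.comp_apply, TensorProduct.map_tmul, LinearEquiv.coe_coe,
      TensorProduct.lid_tmul, smul_eq_mul]
    ring
  | add x y hx hy => simp only [map_add, hx, hy, mul_add]

variable {K₁ : KahlerForm d₁ M₁} {h₁ : HermitianMetric d₁ L₁}
  {K₂ : KahlerForm d₂ M₂} {h₂ : HermitianMetric d₂ L₂}

/-- Evaluation of holomorphic sections at a point. -/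
noncomputable def HolSection.evalAt (K₁ : KahlerForm d₁ M₁) (h₁ : HermitianMetric d₁ L₁) (x : M₁) :
    HolSection K₁ h₁ →ₗ[ℂ] L₁ x :=
  LinearMap.proj x ∘ₗ HolSection.eval

theorem HolSection.eq_zero_of_forall_evalAt_eq_zero {s : HolSection K₁ h₁}
    (hs : ∀ x, HolSection.evalAt K₁ h₁ x s = 0) : s = 0 :=
  eval_injective (funext fun x ↦ by rw [map_zero]; exact hs x)

theorem HolSection.mem_ker_restrict {Λ : Set M₁} {s : HolSection K₁ h₁} :
    s ∈ LinearMap.ker (HolSection.restrict (K := K₁) (h := h₁) Λ) ↔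
      ∀ x ∈ Λ, HolSection.evalAt K₁ h₁ x s = 0 :=
  ⟨fun hs x hx ↦ congrFun hs ⟨x, hx⟩, fun hs ↦ funext fun x ↦ hs x.1 x.2⟩

/-- The holomorphic section of `L₁` obtained from one of `L₁ ⊠ L₂` by fixing the second variable
and contracting with a linear form on the fibre of `L₂`. -/
noncomputable def BoxSection.sliceLeft (K₁ : KahlerForm d₁ M₁) (h₁ : HermitianMetric d₁ L₁)
    (s : BoxSection d₁ d₂ L₁ L₂) (y : M₂) (ξ : Module.Dual ℂ (L₂ y)) : HolSection K₁ h₁ where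
  toFun x := contractRightFactor ξ (s.1 (x, y))
  contMDiff_toFun x₀ := by
    set e₁ := trivializationAt ℂ L₁ x₀
    set e₂ := trivializationAt ℂ L₂ y
    have hx₀ : x₀ ∈ e₁.baseSet := mem_baseSet_trivializationAt ℂ L₁ x₀
    have hy : y ∈ e₂.baseSet := mem_baseSet_trivializationAt ℂ L₂ y
    have h1 := (s.2 e₁ e₂).contMDiffAt (x := (x₀, y))
      ((e₁.open_baseSet.prod e₂.open_baseSet).mem_nhds ⟨hx₀, hy⟩)
    have h2 : ContMDiffAt 𝓘(ℂ, CModel d₁) 𝓘(ℂ, ℂ) ω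
        (fun x ↦ ξ (e₂.symm y 1) * boxCoord e₁ e₂ (x, y) (s.1 (x, y))) x₀ :=
      contMDiffAt_const.mul (ContMDiffAt.comp
        (g := fun p ↦ boxCoord e₁ e₂ p (s.1 p)) x₀ h1 (contMDiffAt_id.prodMk contMDiffAt_const))
    refine (contMDiffAt_section x₀).2 (h2.congr_of_eventuallyEq ?_)
    filter_upwards [e₁.open_baseSet.mem_nhds hx₀] with x hx
    rw [← linearMapAt_contractRightFactor e₁ e₂ (x, y) hy, e₁.linearMapAt_apply, if_pos hx]

/-- The holomorphic section of `L₂` obtained from one of `L₁ ⊠ L₂` by fixing the first variable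
and contracting with a linear form on the fibre of `L₁`. -/
noncomputable def BoxSection.sliceRight (K₂ : KahlerForm d₂ M₂) (h₂ : HermitianMetric d₂ L₂)
    (s : BoxSection d₁ d₂ L₁ L₂) (x : M₁) (η : Module.Dual ℂ (L₁ x)) : HolSection K₂ h₂ where
  toFun y := contractLeftFactor η (s.1 (x, y))
  contMDiff_toFun y₀ := by
    set e₁ := trivializationAt ℂ L₁ x
    set e₂ := trivializationAt ℂ L₂ y₀
    have hx : x ∈ e₁.baseSet := mem_baseSet_trivializationAt ℂ L₁ x
    have hy₀ : y₀ ∈ e₂.baseSet := mem_baseSet_trivializationAt ℂ L₂ y₀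
    have h1 := (s.2 e₁ e₂).contMDiffAt (x := (x, y₀))
      ((e₁.open_baseSet.prod e₂.open_baseSet).mem_nhds ⟨hx, hy₀⟩)
    have h2 : ContMDiffAt 𝓘(ℂ, CModel d₂) 𝓘(ℂ, ℂ) ω
        (fun y ↦ η (e₁.symm x 1) * boxCoord e₁ e₂ (x, y) (s.1 (x, y))) y₀ :=
      contMDiffAt_const.mul (ContMDiffAt.comp
        (g := fun p ↦ boxCoord e₁ e₂ p (s.1 p)) y₀ h1 (contMDiffAt_const.prodMk contMDiffAt_id))
    refine (contMDiffAt_section y₀).2 (h2.congr_of_eventuallyEq ?_)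
    filter_upwards [e₂.open_baseSet.mem_nhds hy₀] with y hy
    rw [← linearMapAt_contractLeftFactor e₁ e₂ (x, y) hx, e₂.linearMapAt_apply, if_pos hy]

/-- Applying `φ` to the slices in the second variable produces a holomorphic section in the first.
For `φ` an evaluation at `y` followed by a form `ξ`, that section is `sliceLeft`, by exchanging
contractions; such `φ` span the dual, and the claim is linear in `φ`. -/
theorem BoxSection.exists_dual_slice [FiniteDimensional ℂ (HolSection K₂ h₂)]
    (s : BoxSection d₁ d₂ L₁ L₂) (φ : Module.Dual ℂ (HolSection K₂ h₂)) :
    ∃ u : HolSection K₁ h₁, ∀ (x : M₁) (η : Module.Dual ℂ (L₁ x)),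
      η (HolSection.evalAt K₁ h₁ x u) = φ (BoxSection.sliceRight K₂ h₂ s x η) := by
  have hspan : Submodule.span ℂ {φ : Module.Dual ℂ (HolSection K₂ h₂) |
      ∃ (y : M₂) (ξ : Module.Dual ℂ (L₂ y)), φ = ξ ∘ₗ HolSection.evalAt K₂ h₂ y} = ⊤ := by
    -- In finite dimension, forms without a common nonzero zero span the dual; a section killed by
    -- all forms at all points is zero.
    refine Submodule.span_eq_top_of_ne_zero fun v hv ↦ ?_
    by_contra! hcon
    refine hv (HolSection.eq_zero_of_forall_evalAt_eq_zero fun y ↦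
      (Module.forall_dual_apply_eq_zero_iff ℂ _).1 fun ξ ↦ hcon _ ⟨y, ξ, rfl⟩)
  have hφ := hspan ▸ Submodule.mem_top (x := φ)
  induction hφ using Submodule.span_induction with
  | mem φ hφ =>
    obtain ⟨y, ξ, rfl⟩ := hφ
    exact ⟨BoxSection.sliceLeft K₁ h₁ s y ξ, fun x η ↦ dual_contractRightFactor η ξ (s.1 (x, y))⟩
  | zero => exact ⟨0, fun x η ↦ by simp⟩
  | add φ ψ _ _ hφ hψ =>
    obtain ⟨u, hu⟩ := hφ
    obtain ⟨v, hv⟩ := hψ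
    exact ⟨u + v, fun x η ↦ by simp [hu, hv]⟩
  | smul c φ _ hφ =>
    obtain ⟨u, hu⟩ := hφ
    exact ⟨c • u, fun x η ↦ by simp [hu]⟩

/-! ### Bijectivity of the canonical map. -/

variable [ContMDiffVectorBundle ω ℂ L₁ 𝓘(ℂ, CModel d₁)]
  [ContMDiffVectorBundle ω ℂ L₂ 𝓘(ℂ, CModel d₂)]

theorem boxMap_apply (t : HolSection K₁ h₁ ⊗[ℂ] HolSection K₂ h₂) (p : M₁ × M₂) :
    (boxMap t).1 p = TensorProduct.map (HolSection.evalAt K₁ h₁ p.1)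
      (HolSection.evalAt K₂ h₂ p.2) t := by
  induction t with
  | zero => simp
  | tmul u v => rfl
  | add t t' ht ht' => rw [map_add, map_add, ← ht, ← ht']; rfl

theorem boxMap_injective :
    Function.Injective (boxMap (K₁ := K₁) (h₁ := h₁) (K₂ := K₂) (h₂ := h₂)) :=
  (injective_iff_map_eq_zero _).2 fun t ht ↦ TensorProduct.eq_zero_of_forall_map_eq_zero
    (fun _ ↦ HolSection.eq_zero_of_forall_evalAt_eq_zero)
    (fun _ ↦ HolSection.eq_zero_of_forall_evalAt_eq_zero) fun x y ↦ by
      rw [← boxMap_apply t (x, y), ht]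
      rfl

/-- The preimage of `s` is `∑ k, u k ⊗ₜ v k`, where `v` is a basis of the second factor and `u k`
collects the `k`-th coordinates of the slices of `s`. Equality is tested pointwise after contracting
with forms `η`, where it becomes the basis expansion of a slice. -/
theorem boxMap_surjective [FiniteDimensional ℂ (HolSection K₂ h₂)] :
    Function.Surjective (boxMap (K₁ := K₁) (h₁ := h₁) (K₂ := K₂) (h₂ := h₂)) := by
  intro s
  let v := Module.finBasis ℂ (HolSection K₂ h₂)
  choose u hu using fun k ↦ BoxSection.exists_dual_slice (K₁ := K₁) (h₁ := h₁) s (v.coord k)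
  refine ⟨∑ k, u k ⊗ₜ[ℂ] v k, Subtype.ext (funext fun p ↦
    eq_of_forall_contractLeftFactor_eq fun η ↦ ?_)⟩
  have h1 : contractLeftFactor η (s.1 p) = HolSection.evalAt K₂ h₂ p.2
      (BoxSection.sliceRight K₂ h₂ s p.1 η) := rfl
  conv_rhs => rw [h1, ← v.sum_repr (BoxSection.sliceRight K₂ h₂ s p.1 η)]
  rw [boxMap_apply, map_sum, map_sum, map_sum]
  refine Finset.sum_congr rfl fun k _ ↦ ?_
  rw [TensorProduct.map_tmul, contractLeftFactor_tmul, hu, map_smul, v.coord_apply]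

/-! ### The kernel of restriction to a product set. -/

theorem mem_boxKer {Λ : Set (M₁ × M₂)} {t : HolSection K₁ h₁ ⊗[ℂ] HolSection K₂ h₂} :
    t ∈ boxKer K₁ h₁ K₂ h₂ Λ ↔ ∀ p ∈ Λ, TensorProduct.map (HolSection.evalAt K₁ h₁ p.1)
      (HolSection.evalAt K₂ h₂ p.2) t = 0 := by
  simp only [← boxMap_apply]
  exact ⟨fun ht p hp ↦ congrFun ht ⟨p, hp⟩, fun ht ↦ funext fun p ↦ ht p.1 p.2⟩

theorem tensorSubspace_le_boxKer {Λ₁ : Set M₁} {Λ₂ : Set M₂} {V : Submodule ℂ (HolSection K₁ h₁)}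
    {W : Submodule ℂ (HolSection K₂ h₂)}
    (h : V ≤ LinearMap.ker (HolSection.restrict Λ₁) ∨ W ≤ LinearMap.ker (HolSection.restrict Λ₂)) :
    tensorSubspace V W ≤ boxKer K₁ h₁ K₂ h₂ (Λ₁ ×ˢ Λ₂) := by
  rw [tensorSubspace_eq_map₂, Submodule.map₂_le]
  refine fun u hu v hv ↦ mem_boxKer.2 fun p hp ↦ ?_
  rw [TensorProduct.mk_apply, TensorProduct.map_tmul]
  rcases h with h | h
  · rw [HolSection.mem_ker_restrict.1 (h hu) p.1 hp.1, TensorProduct.zero_tmul]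
  · rw [HolSection.mem_ker_restrict.1 (h hv) p.2 hp.2, TensorProduct.tmul_zero]

theorem disjoint_boxKer_tensorSubspace {Λ₁ : Set M₁} {Λ₂ : Set M₂}
    {V : Submodule ℂ (HolSection K₁ h₁)} {W : Submodule ℂ (HolSection K₂ h₂)}
    (hV : Disjoint (LinearMap.ker (HolSection.restrict Λ₁)) V)
    (hW : Disjoint (LinearMap.ker (HolSection.restrict Λ₂)) W) :
    Disjoint (boxKer K₁ h₁ K₂ h₂ (Λ₁ ×ˢ Λ₂)) (tensorSubspace V W) := by
  rw [Submodule.disjoint_def]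
  rintro _ ht ⟨t, rfl⟩
  -- Here `t` lives in the tensor product of `V` and `W` themselves. The disjointness hypotheses say
  -- exactly that evaluations at points of `Λ₁`, respectively `Λ₂`, are jointly injective on these
  -- subspaces.
  have h0 : t = 0 := TensorProduct.eq_zero_of_forall_map_eq_zero
    (a := fun x : Λ₁ ↦ HolSection.evalAt K₁ h₁ x.1 ∘ₗ V.subtype)
    (b := fun y : Λ₂ ↦ HolSection.evalAt K₂ h₂ y.1 ∘ₗ W.subtype)
    (fun u hu ↦ Subtype.ext (Submodule.disjoint_def.1 hV u
      (HolSection.mem_ker_restrict.2 fun x hx ↦ hu ⟨x, hx⟩) u.2))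
    (fun v hv ↦ Subtype.ext (Submodule.disjoint_def.1 hW v
      (HolSection.mem_ker_restrict.2 fun y hy ↦ hv ⟨y, hy⟩) v.2))
    fun x y ↦ by
      rw [TensorProduct.map_comp]
      exact mem_boxKer.1 ht (x.1, y.1) ⟨x.2, y.2⟩
  rw [h0, map_zero]

end ExternalProduct

/-! ### The decomposition of the kernel and of its orthogonal complement. -/

theorem proposition3p1 {d₁ d₂ : ℕ} (hd₁ : 1 ≤ d₁) (hd₂ : 1 ≤ d₂)
    {M₁ : Type*} [TopologicalSpace M₁] [T2Space M₁] [CompactSpace M₁] [ConnectedSpace M₁]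
    [MeasurableSpace M₁] [BorelSpace M₁] [ChartedSpace (CModel d₁) M₁]
    [IsManifold 𝓘(ℂ, CModel d₁) ω M₁]
    {M₂ : Type*} [TopologicalSpace M₂] [T2Space M₂] [CompactSpace M₂] [ConnectedSpace M₂]
    [MeasurableSpace M₂] [BorelSpace M₂] [ChartedSpace (CModel d₂) M₂]
    [IsManifold 𝓘(ℂ, CModel d₂) ω M₂]
    {L₁ : M₁ → Type*} [TopologicalSpace (TotalSpace ℂ L₁)] [∀ x, AddCommGroup (L₁ x)]
    [∀ x, Module ℂ (L₁ x)] [∀ x, TopologicalSpace (L₁ x)] [FiberBundle ℂ L₁]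
    [VectorBundle ℂ ℂ L₁] [ContMDiffVectorBundle ω ℂ L₁ 𝓘(ℂ, CModel d₁)]
    {L₂ : M₂ → Type*} [TopologicalSpace (TotalSpace ℂ L₂)] [∀ x, AddCommGroup (L₂ x)]
    [∀ x, Module ℂ (L₂ x)] [∀ x, TopologicalSpace (L₂ x)] [FiberBundle ℂ L₂]
    [VectorBundle ℂ ℂ L₂] [ContMDiffVectorBundle ω ℂ L₂ 𝓘(ℂ, CModel d₂)]
    (K₁ : KahlerForm d₁ M₁) (h₁ : HermitianMetric d₁ L₁)
    (K₂ : KahlerForm d₂ M₂) (h₂ : HermitianMetric d₂ L₂)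
    (Λ₁ : Set M₁) (Λ₂ : Set M₂) (hΛ₁ : Λ₁.Nonempty) (hΛ₂ : Λ₂.Nonempty)
    (hpt : (∃ x, Λ₁ = {x}) ∨ ∃ y, Λ₂ = {y}) :
    let R₁ : HolSection K₁ h₁ →ₗ[ℂ] ∀ x : Λ₁, L₁ x := HolSection.restrict Λ₁
    let R₂ : HolSection K₂ h₂ →ₗ[ℂ] ∀ y : Λ₂, L₂ y := HolSection.restrict Λ₂
    let A₁ := tensorSubspace (⊤ : Submodule ℂ (HolSection K₁ h₁)) (LinearMap.ker R₂)
    let A₂ := tensorSubspace (LinearMap.ker R₁) (LinearMap.ker R₂)ᗮ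
    Function.Bijective (boxMap (K₁ := K₁) (h₁ := h₁) (K₂ := K₂) (h₂ := h₂)) ∧
      boxKer K₁ h₁ K₂ h₂ (Λ₁ ×ˢ Λ₂) = A₁ ⊔ A₂ ∧ A₁ ⟂ A₂ ∧ Disjoint A₁ A₂ ∧
      (boxKer K₁ h₁ K₂ h₂ (Λ₁ ×ˢ Λ₂))ᗮ =
        tensorSubspace (LinearMap.ker R₁)ᗮ (LinearMap.ker R₂)ᗮ := by
  intro R₁ R₂ A₁ A₂
  have : FiniteDimensional ℂ (HolSection K₁ h₁) := HolSection.finiteDimensional K₁ h₁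
  have : FiniteDimensional ℂ (HolSection K₂ h₂) := HolSection.finiteDimensional K₂ h₂
  have hA : A₁ ⟂ A₂ := tensorSubspace_isOrtho (.inr (Submodule.isOrtho_orthogonal_right _))
  have hC : A₁ ⊔ A₂ ⟂ tensorSubspace (LinearMap.ker R₁)ᗮ (LinearMap.ker R₂)ᗮ :=
    Submodule.isOrtho_sup_left.2
      ⟨tensorSubspace_isOrtho (.inr (Submodule.isOrtho_orthogonal_right _)),
        tensorSubspace_isOrtho (.inl (Submodule.isOrtho_orthogonal_right _))⟩
  have hle : A₁ ⊔ A₂ ≤ boxKer K₁ h₁ K₂ h₂ (Λ₁ ×ˢ Λ₂) :=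
    sup_le (tensorSubspace_le_boxKer (.inr le_rfl)) (tensorSubspace_le_boxKer (.inl le_rfl))
  -- Both identities come at once: `A₁ ⊔ A₂` lies in the kernel, and the product of the two
  -- complements is orthogonal to `A₁ ⊔ A₂`, spans the rest, and meets the kernel trivially.
  obtain ⟨hker, horth⟩ := Submodule.eq_and_orthogonal_eq_of_isOrtho hle hC
    (disjoint_boxKer_tensorSubspace (Submodule.orthogonal_disjoint _)
      (Submodule.orthogonal_disjoint _))
    (tensorSubspace_sup_eq_top (LinearMap.ker R₁) (LinearMap.ker R₂))
  exact ⟨⟨boxMap_injective, boxMap_surjective⟩, hker, hA, hA.disjoint, horth⟩
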